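/- Let $r$ and $n$ be integers with $r \ge 3$ and $n \ge r+2$, and let $\mathcal H=(V,\mathcal E)$ be an $r$-uniform hypergraph on $n$ vertices, that is, $|V|=n$ and $\mathcal E$ is a set of $r$-element subsets of $V$; write $|\mathcal H| = |\mathcal E|$. A Hamiltonian Berge cycle in $\mathcal H$ consists of an ordering $v_1,\dots,v_n$ of all the vertices of $\mathcal H$ and distinct edges $e_1,\dots,e_n\in\mathcal E$ such that $v_i\in e_i\cap e_{i+1}$ for $1\le i\le n-1$ and $v_n\in e_n\cap e_1$. A Hamiltonian Berge path in $\mathcal H$ consists of an ordering $v_1,\dots,v_n$ of all the vertices of $\mathcal H$ and distinct edges $e_1,\dots,e_{n-1}\in\mathcal E$ such that $v_i,v_{i+1}\in e_i$ for $1\le i\le n-1$. Let $K_{n-1}^r+v$ be the $r$-uniform hypergraph on $n$ vertices that is the union of the complete $r$-uniform hypergraph $K_{n-1}^r$ on $n-1$ vertices (whose edges are all $r$-element subsets of those vertices) and an isolated vertex $v$, and let $K_{n-1}^r+e$ be the $r$-uniform hypergraph (unique up to isomorphism) obtained from $K_{n-1}^r+v$ by adding one $r$-element edge $e$ that contains $v$.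 1. If $|\mathcal H|\ge\binom{n-1}{r}$, then $\mathcal H$ contains a Hamiltonian Berge path unless $\mathcal H\cong K_{n-1}^r+v$. 2. If $|\mathcal H|>\binom{n-1}{r}$, then $\mathcal H$ contains a Hamiltonian Berge cycle unless $\mathcal H\cong K_{n-1}^r+e$. -/

import Mathlib

namespace Hypergraph

/-- `H` is `r`-uniform: every edge has exactly `r` vertices. -/
def IsUniform {α : Type*} (H : Hypergraph α) (r : ℕ) : Prop :=
  ∀ e ∈ H.edgeSet, e.ncard = r

/-- `v 0, …, v (ℓ - 1)` and `e 0, …, e (ℓ - 1)` form a Berge cycle of length `ℓ` in `H`: the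
vertices are distinct, the edges are distinct, and `v i ∈ e i ∩ e (i + 1)` with indices taken
cyclically (`finRotate ℓ` is the map `i ↦ i + 1` modulo `ℓ`). -/
structure IsBergeCycle {α : Type*} (H : Hypergraph α) (ℓ : ℕ) (v : Fin ℓ → α)
    (e : Fin ℓ → Set α) : Prop where
  vertex_mem : ∀ i, v i ∈ H.vertexSet
  edge_mem : ∀ i, e i ∈ H.edgeSet
  vertex_injective : Function.Injective v
  edge_injective : Function.Injective e
  mem_edge : ∀ i, v i ∈ e i
  mem_next_edge : ∀ i, v i ∈ e (finRotate ℓ i)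

/-- `v 0, …, v k` and `e 0, …, e (k - 1)` form a Berge path with `k + 1` vertices and `k` edges
in `H`: the vertices are distinct, the edges are distinct, and `e i` contains the consecutive
vertices `v i` and `v (i + 1)`. -/
structure IsBergePath {α : Type*} (H : Hypergraph α) (k : ℕ) (v : Fin (k + 1) → α)
    (e : Fin k → Set α) : Prop where
  vertex_mem : ∀ i, v i ∈ H.vertexSet
  edge_mem : ∀ i, e i ∈ H.edgeSet
  vertex_injective : Function.Injective v
  edge_injective : Function.Injective e
  mem_left : ∀ i : Fin k, v i.castSucc ∈ e i
  mem_right : ∀ i : Fin k, v i.succ ∈ e i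

/-- `H` contains a Berge cycle through all of its vertices. -/
def HasHamiltonianBergeCycle {α : Type*} (H : Hypergraph α) : Prop :=
  ∃ (ℓ : ℕ) (v : Fin ℓ → α) (e : Fin ℓ → Set α),
    H.IsBergeCycle ℓ v e ∧ Set.range v = H.vertexSet

/-- `H` contains a Berge path through all of its vertices. -/
def HasHamiltonianBergePath {α : Type*} (H : Hypergraph α) : Prop :=
  ∃ (k : ℕ) (v : Fin (k + 1) → α) (e : Fin k → Set α),
    H.IsBergePath k v e ∧ Set.range v = H.vertexSet

/-- Isomorphism of hypergraphs: a bijection of the vertex sets under which a set of vertices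
is an edge if and only if its image is an edge. -/
def IsIsomorphic {α β : Type*} (H : Hypergraph α) (G : Hypergraph β) : Prop :=
  ∃ f : H.vertexSet ≃ G.vertexSet, ∀ s : Set H.vertexSet,
    Subtype.val '' s ∈ H.edgeSet ↔ Subtype.val '' (f '' s) ∈ G.edgeSet

/-- `K_m^r + v`: the complete `r`-uniform hypergraph on the `m` vertices `some i`, together with
the isolated vertex `none`. -/
def cliqueAddVertex (m r : ℕ) : Hypergraph (Option (Fin m)) where
  vertexSet := Set.univ
  edgeSet := {s | none ∉ s ∧ s.ncard = r}
  subset_vertexSet_of_mem_edgeSet' := fun _ _ => Set.subset_univ _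

/-- `K_m^r + v` with the additional edge `e`. -/
def cliqueAddEdge (m r : ℕ) (e : Set (Option (Fin m))) : Hypergraph (Option (Fin m)) where
  vertexSet := Set.univ
  edgeSet := insert e (cliqueAddVertex m r).edgeSet
  subset_vertexSet_of_mem_edgeSet' := fun _ _ => Set.subset_univ _

/-- `H ≅ K_m^r + e`: up to isomorphism, `H` is `K_m^r + v` with one additional edge `e`, which is
a set of `r` vertices containing the extra vertex. -/
def IsIsomorphicToCliqueAddEdge {α : Type*} (H : Hypergraph α) (m r : ℕ) : Prop :=
  ∃ e : Set (Option (Fin m)), none ∈ e ∧ e.ncard = r ∧ H.IsIsomorphic (cliqueAddEdge m r e)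

end Hypergraph

/-!
The heart of the proof is that an `r`-uniform hypergraph on `n ≥ r + 2` vertices with more than
`(n - 1).choose r` edges, all of whose degrees are at least two, has a Hamiltonian Berge cycle
(`hasCycle_of_two_le_degree`). This gives the second claim: a vertex of degree at most one lies in
exactly one edge, and the other vertices then span a complete hypergraph. For the first claim, one
adds a suitable edge to make all degrees at least two, and removes it from the cycle.

The core statement is proved by induction on `n` for fixed `r`. Double counting (`exists_vertex`)
provides a vertex `x` such that the hypergraph without `x` has more than `(n - 2).choose r` edges
while the degree of `x` is more than half of `(n - 2).choose (r - 1)`. If all degrees remain at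
least two after deleting `x`, there is a Berge cycle through the other vertices. All edges at `x`
are unused by it, and `x` has so many of them that two distinct ones contain consecutive vertices
of the cycle (`exists_insertion`), which allows `x` to be inserted there. Otherwise some vertex `u`
has degree one after the deletion of `x`, and the remaining `n - 2` vertices span a complete
hypergraph; both `u` and `x` are attached to a Hamiltonian path in it
(`hasCycle_of_complete_sub_two`).

The induction starts at `n = r + 2` (`hasCycle_base`), where edges are complements of two-element
sets. A cyclic order of the vertices is the vertex order of a Berge cycle as soon as the pairs of
consecutive vertices can be matched to distinct sets of this kind, each pair being disjoint from the
set matched to it. With at least six edges such an order is obtained from Hall's theorem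
(`exists_matching_of_max`). The remaining case of five edges on five vertices is a finite
computation (`exists_pentagon`).
-/

namespace BergeHam

open Finset

variable {α : Type*}

/-! ### Berge paths and cycles on finite sets -/

section Cycles

variable [DecidableEq α]

/-- `E` contains a Berge path from `a` to `b` whose vertices are exactly the elements of `V`. -/
def HasPath (E : Finset (Finset α)) (V : Finset α) (a b : α) : Prop :=
  ∃ (k : ℕ) (v : Fin (k + 1) → α) (e : Fin k → Finset α),
    Function.Injective v ∧ Function.Injective e ∧ (∀ i, e i ∈ E) ∧
    (∀ i : Fin k, v i.castSucc ∈ e i) ∧ (∀ i : Fin k, v i.succ ∈ e i) ∧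
    univ.image v = V ∧ v 0 = a ∧ v (Fin.last k) = b

/-- `v` and `e` form a Berge cycle of length `m + 1`. The indices are cyclic, and `e i` contains
`v i` and `v (i + 1)`. -/
structure IsCyc {m : ℕ} (v : Fin (m + 1) → α) (e : Fin (m + 1) → Finset α) : Prop where
  inj_v : Function.Injective v
  inj_e : Function.Injective e
  mem : ∀ i, v i ∈ e i
  mem_next : ∀ i, v (i + 1) ∈ e i

/-- `E` contains a Berge cycle whose vertices are exactly the elements of `V`. -/
def HasCycle (E : Finset (Finset α)) (V : Finset α) : Prop :=
  ∃ (m : ℕ) (v : Fin (m + 1) → α) (e : Fin (m + 1) → Finset α),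
    IsCyc v e ∧ (∀ i, e i ∈ E) ∧ univ.image v = V

theorem HasPath.mono {E E' : Finset (Finset α)} {V : Finset α} {a b : α} (h : HasPath E V a b)
    (hE : E ⊆ E') : HasPath E' V a b := by
  obtain ⟨k, v, e, h1, h2, h3, h4⟩ := h
  exact ⟨k, v, e, h1, h2, fun i => hE (h3 i), h4⟩

theorem HasCycle.mono {E E' : Finset (Finset α)} {V : Finset α} (h : HasCycle E V)
    (hE : E ⊆ E') : HasCycle E' V := by
  obtain ⟨m, v, e, h1, h2, h3⟩ := h
  exact ⟨m, v, e, h1, fun i => hE (h2 i), h3⟩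

theorem HasPath.snoc {E : Finset (Finset α)} {V : Finset α} {a b x : α} {f : Finset α}
    (h : HasPath E V a b) (hx : x ∉ V) (hf : f ∉ E) (hb : b ∈ f) (hxf : x ∈ f) :
    HasPath (insert f E) (insert x V) a x := by
  obtain ⟨k, v, e, hv, he, hE, hl, hr, hV, h0, hk⟩ := h
  refine ⟨k + 1, Fin.snoc v x, Fin.snoc e f, ?_, ?_, ?_, ?_, ?_, ?_, ?_, ?_⟩
  · rw [Fin.snoc_injective_iff]
    refine ⟨hv, ?_⟩
    rintro ⟨i, rfl⟩
    exact hx (hV ▸ mem_image_of_mem _ (mem_univ _))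
  · rw [Fin.snoc_injective_iff]
    refine ⟨he, ?_⟩
    rintro ⟨i, rfl⟩
    exact hf (hE i)
  · intro i
    induction i using Fin.lastCases with
    | last => simp
    | cast i => simp [hE i]
  · intro i
    induction i using Fin.lastCases with
    | last => simp [hk, hb]
    | cast i => simpa using hl i
  · intro i
    induction i using Fin.lastCases with
    | last => simp [hxf]
    | cast i => rw [Fin.succ_castSucc, Fin.snoc_castSucc, Fin.snoc_castSucc]; exact hr i
  · ext y
    simp only [mem_image, mem_univ, true_and, mem_insert, ← hV]
    constructor
    · rintro ⟨i, rfl⟩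
      induction i using Fin.lastCases with
      | last => simp
      | cast i => simp
    · rintro (rfl | ⟨i, rfl⟩)
      · exact ⟨Fin.last _, by simp⟩
      · exact ⟨i.castSucc, by simp⟩
  · have : (0 : Fin (k + 1 + 1)) = Fin.castSucc 0 := rfl
    rw [this, Fin.snoc_castSucc, h0]
  · simp

theorem HasPath.close {E : Finset (Finset α)} {V : Finset α} {a b : α} {f : Finset α}
    (h : HasPath E V a b) (hf : f ∉ E) (ha : a ∈ f) (hb : b ∈ f) :
    HasCycle (insert f E) V := by
  obtain ⟨k, v, e, hv, he, hE, hl, hr, hV, h0, hk⟩ := h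
  refine ⟨k, v, Fin.snoc e f, ⟨hv, ?_, ?_, ?_⟩, ?_, hV⟩
  · rw [Fin.snoc_injective_iff]
    refine ⟨he, ?_⟩
    rintro ⟨i, rfl⟩
    exact hf (hE i)
  · intro i
    induction i using Fin.lastCases with
    | last => simp [hk, hb]
    | cast i => simpa using hl i
  · intro i
    induction i using Fin.lastCases with
    | last => simp [h0, ha]
    | cast i => rw [Fin.coeSucc_eq_succ]; simpa using hr i
  · intro i
    induction i using Fin.lastCases with
    | last => simp
    | cast i => simp [hE i]

/-- Removing the edge `e i` opens a Berge cycle to a Berge path. -/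
theorem IsCyc.hasPath {m : ℕ} {v : Fin (m + 1) → α} {e : Fin (m + 1) → Finset α}
    (h : IsCyc v e) (i : Fin (m + 1)) {E : Finset (Finset α)} (hE : ∀ j, j ≠ i → e j ∈ E) :
    HasPath E (univ.image v) (v (i + 1)) (v i) := by
  have hlast : Fin.last m + (i + 1) = i := by
    rw [add_comm i 1, ← add_assoc, Fin.last_add_one, zero_add]
  refine ⟨m, fun j => v (j + (i + 1)), fun j => e (j.castSucc + (i + 1)), ?_, ?_, ?_, ?_, ?_, ?_,
    ?_, ?_⟩
  · exact fun j k hjk => add_right_cancel (h.inj_v hjk)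
  · exact fun j k hjk => Fin.castSucc_injective _ (add_right_cancel (h.inj_e hjk))
  · intro j
    apply hE
    intro hj
    rw [← hlast] at hj
    have := add_right_cancel (a := j.castSucc) (b := i + 1) (c := Fin.last m)
      (by simpa [hlast] using hj)
    exact (Fin.castSucc_lt_last j).ne this
  · exact fun j => h.mem _
  · intro j
    have := h.mem_next (j.castSucc + (i + 1))
    rwa [add_right_comm, Fin.coeSucc_eq_succ] at this
  · ext y
    simp only [mem_image, mem_univ, true_and]
    constructor
    · rintro ⟨j, rfl⟩
      exact ⟨_, rfl⟩
    · rintro ⟨j, rfl⟩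
      exact ⟨j - (i + 1), by rw [sub_add_cancel]⟩
  · simp
  · simp only [hlast]

/-- A cycle using at most one edge outside `E` yields a path inside `E`. -/
theorem HasCycle.exists_hasPath {E : Finset (Finset α)} {V : Finset α} {f : Finset α}
    (h : HasCycle (insert f E) V) : ∃ a b, HasPath E V a b := by
  obtain ⟨m, v, e, hc, hE, rfl⟩ := h
  by_cases hf : ∃ i, e i = f
  · obtain ⟨i, hi⟩ := hf
    refine ⟨_, _, hc.hasPath i fun j hj => ?_⟩
    exact (mem_insert.1 (hE j)).resolve_left fun h => hj (hc.inj_e (h.trans hi.symm))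
  · push Not at hf
    exact ⟨_, _, hc.hasPath 0 fun j _ => (mem_insert.1 (hE j)).resolve_left (hf j)⟩

/-- A cyclic ordering of a finite set in which three prescribed vertices come first, second and
last. -/
theorem exists_ordering {V : Finset α} {m : ℕ} (hV : #V = m + 1) (hm : 2 ≤ m) {a b c : α}
    (ha : a ∈ V) (hb : b ∈ V) (hc : c ∈ V) (hab : a ≠ b) (hac : a ≠ c) (hbc : b ≠ c) :
    ∃ v : Fin (m + 1) → α, Function.Injective v ∧ univ.image v = V ∧
      v 0 = a ∧ v 1 = b ∧ v (Fin.last m) = c := by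
  have h01 : (0 : Fin (m + 1)) ≠ 1 := by
    rw [Ne, Fin.ext_iff, Fin.val_zero, Fin.val_one', Nat.mod_eq_of_lt (by omega)]; omega
  have h0l : (0 : Fin (m + 1)) ≠ Fin.last m := by
    rw [Ne, Fin.ext_iff, Fin.val_zero, Fin.val_last]; omega
  have h1l : (1 : Fin (m + 1)) ≠ Fin.last m := by
    rw [Ne, Fin.ext_iff, Fin.val_last, Fin.val_one', Nat.mod_eq_of_lt (by omega)]; omega
  obtain ⟨g, hg⟩ := exists_equiv_extend_of_card_eq (α := Fin (m + 1)) (t := V)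
    (by simp [hV]) (s := {0, 1, Fin.last m})
    (f := fun i => if i = 0 then a else if i = 1 then b else c)
    (by
      intro y hy
      simp only [mem_image] at hy
      obtain ⟨i, -, rfl⟩ := hy
      split_ifs <;> assumption)
    (by
      intro i hi j hj hij
      simp only [coe_insert, coe_singleton, Set.mem_insert_iff, Set.mem_singleton_iff] at hi hj
      rcases hi with rfl | rfl | rfl <;> rcases hj with rfl | rfl | rfl <;>
        simp_all [Ne.symm])
  refine ⟨fun i => g i, fun i j hij => g.injective (Subtype.ext hij), ?_, ?_, ?_, ?_⟩
  · ext y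
    simp only [mem_image, mem_univ, true_and]
    constructor
    · rintro ⟨i, rfl⟩
      exact (g i).2
    · exact fun hy => ⟨g.symm ⟨y, hy⟩, by simp⟩
  · simp [hg 0 (by simp)]
  · simp [hg 1 (by simp), h01.symm]
  · simp [hg (Fin.last m) (by simp), h0l.symm, h1l.symm]

/-- In a cyclic ordering of more than `r` vertices the `r`-sets of consecutive vertices are
distinct, and they are the edges of a Berge cycle. -/
theorem isCyc_intervals {m r : ℕ} (hr : 2 ≤ r) (hm : r ≤ m) {v : Fin (m + 1) → α}
    (hv : Function.Injective v) :
    IsCyc v fun i => (univ.filter fun k : Fin (m + 1) => (k - i).val < r).image v := by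
  have key : ∀ i k : Fin (m + 1),
      v k ∈ (univ.filter fun k : Fin (m + 1) => (k - i).val < r).image v ↔ (k - i).val < r := by
    intro i k
    simp [hv.eq_iff]
  refine ⟨hv, ?_, ?_, ?_⟩
  · intro i j hij
    by_contra hne
    simp only at hij
    have h1 : (i - j).val < r := by
      rw [← key j i, ← hij, key i i, sub_self, Fin.val_zero]
      omega
    have h2 : ¬ (i - 1 - j).val < r := by
      rw [← key j (i - 1)]
      rw [← hij, key i (i - 1)]
      have : i - 1 - i = Fin.last m := by
        rw [sub_sub_cancel_left]
        exact neg_eq_of_add_eq_zero_left (Fin.last_add_one m)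
      rw [this, Fin.val_last]
      omega
    have h3 : i - 1 - j = (i - j) - 1 := sub_right_comm _ _ _
    rw [h3, Fin.val_sub_one_of_ne_zero (sub_ne_zero.2 hne)] at h2
    omega
  · intro i
    rw [key]; simp; omega
  · intro i
    rw [key, add_sub_cancel_left, Fin.val_one', Nat.mod_eq_of_lt (by omega)]
    omega

theorem card_interval {m r : ℕ} (hm : r ≤ m) (i : Fin (m + 1)) :
    #(univ.filter fun k : Fin (m + 1) => (k - i).val < r) = r := by
  have h : #(univ.filter fun k : Fin (m + 1) => k.val < r) = r := by
    rw [Fin.card_filter_val_lt]; omega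
  rw [← h]
  refine card_bij (fun k _ => k - i) ?_ ?_ ?_
  · intro k hk
    simpa [h] using hk
  · intro a _ b _ hab
    exact sub_left_injective hab
  · intro b hb
    refine ⟨b + i, ?_, by simp⟩
    simpa [h] using hb

/-- In a complete `r`-uniform hypergraph on more than `r` vertices any two vertices are joined by
a Hamiltonian Berge path. -/
theorem hasPath_complete {W : Finset α} {r : ℕ} (hr : 2 ≤ r) (hW : r + 1 ≤ #W) {a b : α}
    (ha : a ∈ W) (hb : b ∈ W) (hab : a ≠ b) : HasPath (W.powersetCard r) W a b := by
  obtain ⟨m, hm⟩ : ∃ m, #W = m + 1 := ⟨#W - 1, by omega⟩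
  obtain ⟨c, hc⟩ : ((W.erase a).erase b).Nonempty := by
    rw [← card_pos]
    have h1 := pred_card_le_card_erase (s := W.erase a) (a := b)
    have h2 := pred_card_le_card_erase (s := W) (a := a)
    omega
  simp only [mem_erase] at hc
  obtain ⟨v, hv, hvW, h0, -, hl⟩ := exists_ordering hm (by omega) ha hc.2.2 hb
    (Ne.symm hc.2.1) hab hc.1
  have hc := isCyc_intervals hr (by omega : r ≤ m) hv
  have hp := hc.hasPath (Fin.last m) (E := W.powersetCard r) fun j _ => by
    rw [mem_powersetCard]
    refine ⟨?_, ?_⟩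
    · rw [← hvW]
      exact image_subset_image (subset_univ _)
    · rw [card_image_of_injective _ hv, card_interval (by omega)]
  rwa [Fin.last_add_one, hvW, h0, hl] at hp

end Cycles

/-! ### Degree counting -/

section Counting

variable [DecidableEq α]

theorem sum_card_not_mem {V : Finset α} {E : Finset (Finset α)} {r : ℕ}
    (hE : E ⊆ V.powersetCard r) : ∑ x ∈ V, #{e ∈ E | x ∉ e} = (#V - r) * #E := by
  have h := sum_card_bipartiteAbove_eq_sum_card_bipartiteBelow (fun (x : α) e => x ∉ e)
    (s := V) (t := E)
  simp only [bipartiteAbove, bipartiteBelow] at h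
  rw [h, sum_congr rfl (g := fun _ => #V - r), sum_const, smul_eq_mul, mul_comm]
  intro e he
  obtain ⟨heV, her⟩ := mem_powersetCard.1 (hE he)
  rw [filter_notMem_eq_sdiff, card_sdiff_of_subset heV, her]

theorem card_filter_not_mem_le {V : Finset α} {E : Finset (Finset α)} {r : ℕ}
    (hE : E ⊆ V.powersetCard r) {x : α} (hx : x ∈ V) :
    #{e ∈ E | x ∉ e} ≤ (#V - 1).choose r := by
  rw [← card_erase_of_mem hx, ← card_powersetCard]
  refine card_le_card fun e he => ?_
  rw [mem_filter] at he
  obtain ⟨heV, her⟩ := mem_powersetCard.1 (hE he.1)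
  exact mem_powersetCard.2 ⟨subset_erase.2 ⟨heV, he.2⟩, her⟩

theorem filter_not_mem_subset {V : Finset α} {E : Finset (Finset α)} {r : ℕ}
    (hE : E ⊆ V.powersetCard r) (x : α) :
    E.filter (x ∉ ·) ⊆ (V.erase x).powersetCard r := by
  intro e he
  rw [mem_filter] at he
  obtain ⟨heV, her⟩ := mem_powersetCard.1 (hE he.1)
  exact mem_powersetCard.2 ⟨subset_erase.2 ⟨heV, he.2⟩, her⟩

/-- In a dense hypergraph there is a vertex whose deletion leaves a dense hypergraph, and whose
degree is nevertheless large. Double counting shows that at least two vertices have the first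
property; the degrees of these two add up to more than `N.choose s`. -/
theorem exists_vertex {V : Finset α} {E : Finset (Finset α)} {N s : ℕ} (hV : #V = N + 2)
    (hN : s + 1 ≤ N) (hE : E ⊆ V.powersetCard (s + 1)) (hcard : (N + 1).choose (s + 1) < #E) :
    ∃ x ∈ V, N.choose (s + 1) < #{e ∈ E | x ∉ e} ∧ N.choose s < 2 * #{e ∈ E | x ∈ e} := by
  set L := V.filter fun x => N.choose (s + 1) < #{e ∈ E | x ∉ e} with hL
  have hpas : (N + 1).choose (s + 1) = N.choose s + N.choose (s + 1) := Nat.choose_succ_succ _ _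
  have hL2 : 1 < #L := by
    by_contra! hle
    obtain ⟨d, hd⟩ : ∃ d, #E = N.choose (s + 1) + d := ⟨_, (Nat.add_sub_of_le (by omega)).symm⟩
    have hsum := sum_card_not_mem hE
    have hup : ∑ x ∈ V, #{e ∈ E | x ∉ e} ≤
        ∑ x ∈ V, (N.choose (s + 1) + if x ∈ L then d else 0) := by
      refine sum_le_sum fun x hx => ?_
      split_ifs with h
      · rw [← hd]; exact card_filter_le _ _
      · simpa [hL, hx] using h
    rw [sum_add_distrib, sum_const, ← sum_filter, sum_const, smul_eq_mul, smul_eq_mul,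
      hsum, hV] at hup
    have hfl : #(V.filter (· ∈ L)) ≤ 1 := by
      refine le_trans (card_le_card fun x hx => (mem_filter.1 hx).2) hle
    obtain ⟨q, rfl⟩ : ∃ q, N = s + 1 + q := ⟨_, (Nat.add_sub_of_le hN).symm⟩
    have hid := Nat.choose_mul_succ_eq (s + 1 + q) (s + 1)
    rw [show s + 1 + q + 1 - (s + 1) = q + 1 by omega] at hid
    rw [show s + 1 + q + 2 - (s + 1) = q + 2 by omega] at hup
    have h1 : #(V.filter (· ∈ L)) * d ≤ 1 * d := Nat.mul_le_mul_right _ hfl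
    have h2 : (q + 1) * ((s + 1 + q + 1).choose (s + 1) + 1) ≤ (q + 1) * #E :=
      Nat.mul_le_mul_left _ hcard
    nlinarith
  obtain ⟨x, hx, y, hy, hxy⟩ := one_lt_card.1 hL2
  rw [hL, mem_filter] at hx hy
  have hcover : #E ≤ #{e ∈ E | x ∈ e} + #{e ∈ E | y ∈ e} + N.choose (s + 1) := by
    have hc : #((V.erase x).erase y) = N := by
      rw [card_erase_of_mem (mem_erase.2 ⟨hxy.symm, hy.1⟩), card_erase_of_mem hx.1, hV]; rfl
    rw [← hc, ← card_powersetCard]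
    refine le_trans (card_le_card fun e he => ?_) ((card_union_le _ _).trans
      (Nat.add_le_add_right (card_union_le _ _) _))
    obtain ⟨heV, her⟩ := mem_powersetCard.1 (hE he)
    simp only [mem_union, mem_filter, mem_powersetCard, he, true_and, her, and_true]
    by_cases h1 : x ∈ e
    · exact Or.inl (Or.inl h1)
    by_cases h2 : y ∈ e
    · exact Or.inl (Or.inr h2)
    · exact Or.inr (subset_erase.2 ⟨subset_erase.2 ⟨heV, h1⟩, h2⟩)
  by_cases hdx : N.choose s < 2 * #{e ∈ E | x ∈ e}
  · exact ⟨x, hx.1, hx.2, hdx⟩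
  · exact ⟨y, hy.1, hy.2, by omega⟩

/-- A vertex `x` of large degree can be inserted between two consecutive vertices of any cyclic
ordering of the others. Otherwise two cyclically consecutive vertices lie together in at most
`(m - 2).choose s` edges of `D`, since a vertex in two edges of `D` forces both of its neighbours
to lie in none; summing over the cycle bounds the size of `D`. -/
theorem exists_insertion {m t : ℕ} {v : Fin (m + 3) → α} (hv : Function.Injective v)
    (hm : t + 2 ≤ m) {x : α} (hx : x ∉ univ.image v) {D : Finset (Finset α)}
    (hD : D ⊆ (insert x (univ.image v)).powersetCard (t + 3)) (hxD : ∀ e ∈ D, x ∈ e)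
    (hcard : (m + 2).choose (t + 2) < 2 * #D) :
    ∃ i, ∃ A ∈ D, ∃ B ∈ D, A ≠ B ∧ v i ∈ A ∧ v (i + 1) ∈ B := by
  by_contra! H
  set d : Fin (m + 3) → ℕ := fun i => #{A ∈ D | v i ∈ A} with hd
  have hsum : ∑ i, d i = (t + 2) * #D := by
    have h := sum_card_bipartiteAbove_eq_sum_card_bipartiteBelow (fun i e => v i ∈ e)
      (s := univ) (t := D)
    simp only [bipartiteAbove, bipartiteBelow] at h
    rw [hd, h, sum_congr rfl (g := fun _ => t + 2), sum_const, smul_eq_mul, mul_comm]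
    intro e he
    obtain ⟨heV, her⟩ := mem_powersetCard.1 (hD he)
    rw [← card_image_of_injective _ hv, show t + 2 = #(e.erase x) by
      rw [card_erase_of_mem (hxD e he), her]; rfl]
    congr 1
    ext y
    simp only [mem_image, mem_filter, mem_univ, true_and, mem_erase]
    constructor
    · rintro ⟨i, hi, rfl⟩
      exact ⟨fun h => hx (h ▸ mem_image_of_mem _ (mem_univ _)), hi⟩
    · rintro ⟨hyx, hy⟩
      obtain ⟨i, -, rfl⟩ := mem_image.1 ((mem_insert.1 (heV hy)).resolve_left hyx)
      exact ⟨i, hy, rfl⟩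
  have hright : ∀ i, 2 ≤ d i → d (i + 1) = 0 := by
    intro i hi
    rw [hd, card_eq_zero, filter_eq_empty_iff]
    intro B hB hBi
    obtain ⟨A, hA, A', hA', hne⟩ := one_lt_card.1 hi
    rw [mem_filter] at hA hA'
    have h1 : A = B := by_contra fun h => H i A hA.1 B hB h hA.2 hBi
    have h2 : A' = B := by_contra fun h => H i A' hA'.1 B hB h hA'.2 hBi
    exact hne (h1.trans h2.symm)
  have hleft : ∀ i, 2 ≤ d (i + 1) → d i = 0 := by
    intro i hi
    rw [hd, card_eq_zero, filter_eq_empty_iff]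
    intro B hB hBi
    obtain ⟨A, hA, A', hA', hne⟩ := one_lt_card.1 hi
    rw [mem_filter] at hA hA'
    have h1 : B = A := by_contra fun h => H i B hB A hA.1 h hBi hA.2
    have h2 : B = A' := by_contra fun h => H i B hB A' hA'.1 h hBi hA'.2
    exact hne (h1.symm.trans h2)
  have hbound : ∀ i, 2 ≤ d i → d i ≤ m.choose (t + 1) := by
    intro i hi
    have hr := hright i hi
    have hl := hleft (i - 1) (by rwa [sub_add_cancel])
    rw [hd, card_eq_zero, filter_eq_empty_iff] at hr hl
    have hT : #(((univ.erase i).erase (i + 1)).erase (i - 1)) = m := by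
      rw [card_erase_of_mem, card_erase_of_mem, card_erase_of_mem (mem_univ _), card_univ,
        Fintype.card_fin]
      · rfl
      · simp
      · simp only [mem_erase, mem_univ, and_true]
        refine ⟨?_, by simp⟩
        intro h
        have h2 : (1 : Fin (m + 3)) + 1 = 0 := by
          have : i = i + (1 + 1) := by rw [← add_assoc, ← h, sub_add_cancel]
          simpa using this
        have h3 := congrArg Fin.val h2
        simp [Fin.val_add] at h3
        rw [Nat.mod_eq_of_lt (by omega)] at h3
        omega
    rw [← hT, ← card_image_of_injective _ hv, ← card_powersetCard]
    refine card_le_card_of_injOn (fun A => (A.erase x).erase (v i)) ?_ ?_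
    · intro A hA
      rw [mem_coe, mem_filter] at hA
      obtain ⟨hAV, hAr⟩ := mem_powersetCard.1 (hD hA.1)
      have hxi : v i ≠ x := fun h => hx (h ▸ mem_image_of_mem _ (mem_univ _))
      rw [mem_coe, mem_powersetCard, card_erase_of_mem (mem_erase.2 ⟨hxi, hA.2⟩),
        card_erase_of_mem (hxD A hA.1), hAr]
      refine ⟨?_, rfl⟩
      intro y hy
      simp only [mem_erase] at hy
      obtain ⟨j, -, rfl⟩ := mem_image.1 ((mem_insert.1 (hAV hy.2.2)).resolve_left hy.2.1)
      refine mem_image_of_mem _ ?_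
      simp only [mem_erase, mem_univ, and_true]
      refine ⟨?_, ?_, ?_⟩
      · rintro rfl; exact hl hA.1 hy.2.2
      · rintro rfl; exact hr hA.1 hy.2.2
      · rintro rfl; exact hy.1 rfl
    · intro A hA B hB hAB
      rw [mem_coe, mem_filter] at hA hB
      have hxi : v i ≠ x := fun h => hx (h ▸ mem_image_of_mem _ (mem_univ _))
      have h1 := congrArg (fun s => insert x (insert (v i) s)) hAB
      simp only at h1
      rwa [insert_erase (mem_erase.2 ⟨hxi, hA.2⟩), insert_erase (mem_erase.2 ⟨hxi, hB.2⟩),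
        insert_erase (hxD A hA.1), insert_erase (hxD B hB.1)] at h1
  have ha2 : 2 ≤ m.choose (t + 1) := by
    obtain ⟨q, rfl⟩ : ∃ q, m = q + 1 := ⟨m - 1, by omega⟩
    change 2 ≤ q.choose t + q.choose (t + 1)
    have h1 := Nat.choose_pos (show t ≤ q by omega)
    have h2 := Nat.choose_pos (show t + 1 ≤ q by omega)
    omega
  have hpair : ∀ i, d i + d (i + 1) ≤ m.choose (t + 1) := by
    intro i
    by_cases h1 : 2 ≤ d i
    · rw [hright i h1]; exact hbound i h1
    by_cases h2 : 2 ≤ d (i + 1)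
    · rw [hleft i h2, zero_add]; exact hbound _ h2
    omega
  have hshift : ∑ i, d (i + 1) = ∑ i, d i := Equiv.sum_comp (Equiv.addRight 1) d
  have htot : 2 * ((t + 2) * #D) ≤ (m + 3) * m.choose (t + 1) := by
    have := sum_le_sum fun i (_ : i ∈ univ) => hpair i
    rw [sum_add_distrib, hshift, hsum, sum_const, smul_eq_mul, card_univ, Fintype.card_fin] at this
    omega
  have e1 := Nat.add_one_mul_choose_eq (m + 1) (t + 1)
  have e2 := Nat.choose_succ_succ m t
  have e3 := Nat.choose_succ_right_eq m t
  obtain ⟨q, rfl⟩ : ∃ q, m = t + q := ⟨m - t, by omega⟩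
  rw [Nat.add_sub_cancel_left] at e3
  simp only [Nat.succ_eq_add_one] at e2
  rw [show t + q + 1 + 1 = t + q + 2 by rfl, show t + 1 + 1 = t + 2 by rfl, e2] at e1
  have h5 : (t + 2) * ((t + q + 2).choose (t + 2) + 1) ≤ (t + 2) * (2 * #D) :=
    Nat.mul_le_mul_left _ hcard
  have h6 := Nat.choose_pos (show t ≤ t + q by omega)
  generalize (t + q).choose t = b at *
  generalize (t + q).choose (t + 1) = a at *
  nlinarith [Nat.zero_le (t * a), Nat.zero_le (t * b)]

end Counting

/-! ### Hypergraphs on `r + 2` vertices -/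

section Matching

variable {m : ℕ}

/-- The set `g` meets the pair `{i, i + 1}`. -/
def Covers (g : Finset (Fin (m + 1))) (i : Fin (m + 1)) : Prop := i ∈ g ∨ i + 1 ∈ g

instance (g : Finset (Fin (m + 1))) (i : Fin (m + 1)) : Decidable (Covers g i) :=
  inferInstanceAs (Decidable (_ ∨ _))

theorem fin_add_two_ne (hm : 2 ≤ m) (i : Fin (m + 1)) : i + 1 + 1 ≠ i := by
  intro h
  have h1 : (1 : Fin (m + 1)) + 1 = 0 := by simpa [add_assoc] using h
  have h2 := congrArg Fin.val h1
  rw [Fin.val_add, Fin.val_one', Nat.mod_eq_of_lt (a := 1) (by omega),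
    Nat.mod_eq_of_lt (by omega)] at h2
  simp at h2

/-- A two-element set containing `p` is determined by its other element, and pairs that avoid `p`
have to be met by that element. -/
theorem card_covering_le {G : Finset (Finset (Fin (m + 1)))} (h2 : ∀ g ∈ G, #g = 2)
    {p : Fin (m + 1)} {T : Finset (Fin (m + 1))} (hp : ∀ j ∈ T, p ≠ j ∧ p ≠ j + 1) :
    #{g ∈ G | p ∈ g ∧ ∀ j ∈ T, Covers g j} ≤
      #(univ.filter fun y : Fin (m + 1) => ∀ j ∈ T, y = j ∨ y = j + 1) := by
  refine le_trans (card_le_card (t := (univ.filter fun y : Fin (m + 1) =>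
    ∀ j ∈ T, y = j ∨ y = j + 1).image fun y => {p, y}) ?_) card_image_le
  intro g hg
  rw [mem_filter] at hg
  obtain ⟨hgG, hpg, hT⟩ := hg
  obtain ⟨y, hy⟩ := card_eq_one.1 (show #(g.erase p) = 1 by rw [card_erase_of_mem hpg, h2 g hgG])
  have hgy : {p, y} = g := by rw [← insert_erase hpg, hy]
  refine mem_image.2 ⟨y, mem_filter.2 ⟨mem_univ _, fun j hj => ?_⟩, hgy⟩
  rcases hT j hj with h | h
  · rw [← hgy, mem_insert, mem_singleton] at h
    exact Or.inl (h.resolve_left (hp j hj).1.symm).symm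
  · rw [← hgy, mem_insert, mem_singleton] at h
    exact Or.inr (h.resolve_left (hp j hj).2.symm).symm

theorem card_common_le_two {T : Finset (Fin (m + 1))} (hT : T.Nonempty) :
    #(univ.filter fun y : Fin (m + 1) => ∀ j ∈ T, y = j ∨ y = j + 1) ≤ 2 := by
  obtain ⟨j, hj⟩ := hT
  refine le_trans (card_le_card (t := {j, j + 1}) fun y hy => ?_) card_le_two
  simpa using (mem_filter.1 hy).2 j hj

theorem card_common_le_one (hm : 2 ≤ m) {T : Finset (Fin (m + 1))} (hT : 2 ≤ #T) :
    #(univ.filter fun y : Fin (m + 1) => ∀ j ∈ T, y = j ∨ y = j + 1) ≤ 1 := by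
  obtain ⟨j, hj, k, hk, hjk⟩ := one_lt_card.1 hT
  rw [card_le_one]
  intro y hy z hz
  have hyj := (mem_filter.1 hy).2 j hj
  have hyk := (mem_filter.1 hy).2 k hk
  have hzj := (mem_filter.1 hz).2 j hj
  have hzk := (mem_filter.1 hz).2 k hk
  have n1 := fin_add_two_ne hm j
  have n2 := fin_add_two_ne hm k
  by_contra hne
  rcases hyj with rfl | rfl <;> rcases hyk with h1 | h1 <;> rcases hzj with rfl | rfl <;>
    rcases hzk with h2 | h2 <;> simp_all

open Fin.NatCast in
theorem exists_mem_sub_one_not_mem {S : Finset (Fin (m + 1))} (hS : S.Nonempty)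
    (hS' : #S < m + 1) : ∃ i ∈ S, i - 1 ∉ S := by
  by_contra! h
  obtain ⟨i, hi⟩ := hS
  have hall : ∀ k : ℕ, i - (k : Fin (m + 1)) ∈ S := by
    intro k
    induction k with
    | zero => simpa using hi
    | succ k ih =>
      have := h _ ih
      rwa [sub_sub, ← Nat.cast_succ] at this
  have : S = univ := by
    refine eq_univ_iff_forall.2 fun j => ?_
    have := hall (i - j).val
    rwa [Fin.cast_val_eq_self, sub_sub_cancel] at this
  rw [this, card_univ, Fintype.card_fin] at hS'
  exact lt_irrefl _ hS'

/-- At least six two-element subsets of a cycle can be matched to the pairs of consecutive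
vertices of the cycle so that each pair avoids its set, provided that every consecutive pair avoids
one of the sets, and that for any two adjacent pairs at least two of the sets do not meet both.
By Hall's theorem, as a two-element set meets at most four consecutive pairs, and few sets meet
three or four given ones. -/
theorem exists_matching (hm : 4 ≤ m) {G : Finset (Finset (Fin (m + 1)))} (h2 : ∀ g ∈ G, #g = 2)
    (hG : m + 1 ≤ #G) (h6 : 6 ≤ #G) (hpair : ∀ i, ∃ g ∈ G, ¬ Covers g i)
    (htriple : ∀ i, ∃ g ∈ G, ∃ g' ∈ G, g ≠ g' ∧ ¬ (Covers g i ∧ Covers g (i + 1)) ∧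
      ¬ (Covers g' i ∧ Covers g' (i + 1))) :
    ∃ f : Fin (m + 1) → Finset (Fin (m + 1)), Function.Injective f ∧
      ∀ i, f i ∈ G ∧ ¬ Covers (f i) i := by
  suffices hHall : ∀ S : Finset (Fin (m + 1)), #S + #{g ∈ G | ∀ i ∈ S, Covers g i} ≤ #G by
    obtain ⟨f, hf, hf'⟩ := (all_card_le_biUnion_card_iff_exists_injective
      (fun i => G.filter fun g => ¬ Covers g i)).1 fun S => by
        have h := hHall S
        have hc := card_filter_add_card_filter_not (s := G) fun g => ∀ i ∈ S, Covers g i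
        have : S.biUnion (fun i => G.filter fun g => ¬ Covers g i) =
            G.filter fun g => ¬ ∀ i ∈ S, Covers g i := by
          ext g
          simp only [mem_biUnion, mem_filter]
          push Not
          exact ⟨fun ⟨i, hi, hg, h⟩ => ⟨hg, i, hi, h⟩, fun ⟨hg, i, hi, h⟩ => ⟨i, hi, hg, h⟩⟩
        rw [this]
        omega
    exact ⟨f, hf, fun i => mem_filter.1 (hf' i)⟩
  intro S
  have hsplit : ∀ i ∈ S, ∀ T T' : Finset (Fin (m + 1)), T ⊆ S → T' ⊆ S →
      (∀ j ∈ T, i ≠ j ∧ i ≠ j + 1) → (∀ j ∈ T', i + 1 ≠ j ∧ i + 1 ≠ j + 1) →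
      #{g ∈ G | ∀ i ∈ S, Covers g i} ≤
        #(univ.filter fun y : Fin (m + 1) => ∀ j ∈ T, y = j ∨ y = j + 1) +
        #(univ.filter fun y : Fin (m + 1) => ∀ j ∈ T', y = j ∨ y = j + 1) := by
    intro i hi T T' hT hT' hp hp'
    refine le_trans (le_trans (card_le_card fun g hg => ?_) (card_union_le _ _))
      (Nat.add_le_add (card_covering_le h2 hp) (card_covering_le h2 hp'))
    rw [mem_filter] at hg
    rcases hg.2 i hi with h | h
    · exact mem_union_left _ (mem_filter.2 ⟨hg.1, h, fun j hj => hg.2 j (hT hj)⟩)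
    · exact mem_union_right _ (mem_filter.2 ⟨hg.1, h, fun j hj => hg.2 j (hT' hj)⟩)
  have hSle : #S ≤ m + 1 := by simpa using card_le_univ S
  -- five or more consecutive pairs are not all met by one two-element set
  by_cases h5 : 5 ≤ #S
  · have : #{g ∈ G | ∀ i ∈ S, Covers g i} = 0 := by
      rw [card_eq_zero, filter_eq_empty_iff]
      intro g hg hcov
      obtain ⟨x, y, -, rfl⟩ := card_eq_two.1 (h2 g hg)
      have hsub : S ⊆ {x, x - 1, y, y - 1} := by
        intro i hi
        have := hcov i hi
        simp only [Covers, mem_insert, mem_singleton, ← eq_sub_iff_add_eq] at this ⊢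
        tauto
      have := (card_le_card hsub).trans card_le_four
      omega
    omega
  -- choosing `i` with `i - 1 ∉ S`, the vertex `i` meets no other pair of `S`, and `i + 1` meets at
  -- most one other pair
  by_cases h3 : 3 ≤ #S
  · obtain ⟨i, hi, hi'⟩ := exists_mem_sub_one_not_mem (card_pos.1 (by omega : 0 < #S))
      (by omega)
    have hb := hsplit i hi (S.erase i) ((S.erase i).erase (i + 1)) (erase_subset _ _)
      ((erase_subset _ _).trans (erase_subset _ _))
      (by
        intro j hj
        rw [mem_erase] at hj
        refine ⟨hj.1.symm, ?_⟩
        rintro rfl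
        exact hi' (by simpa using hj.2))
      (by
        intro j hj
        simp only [mem_erase] at hj
        exact ⟨hj.1.symm, fun h => hj.2.1 (add_right_cancel h).symm⟩)
    have c1 : #(S.erase i) = #S - 1 := card_erase_of_mem hi
    have c2 : #(S.erase i) - 1 ≤ #((S.erase i).erase (i + 1)) := pred_card_le_card_erase
    have b1 := card_common_le_one (by omega) (show 2 ≤ #(S.erase i) by omega)
    have b2 := card_common_le_two (card_pos.1 (show 0 < #((S.erase i).erase (i + 1)) by omega))
    by_cases h4 : #S = 4
    · have b3 := card_common_le_one (by omega) (show 2 ≤ #((S.erase i).erase (i + 1)) by omega)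
      omega
    · omega
  have hadj : ∀ i, S = {i, i + 1} → #S + #{g ∈ G | ∀ i ∈ S, Covers g i} ≤ #G := by
    rintro i rfl
    obtain ⟨g, hg, g', hg', hne, hc, hc'⟩ := htriple i
    have hsub : G.filter (fun g => ∀ j ∈ ({i, i + 1} : Finset _), Covers g j) ⊆
        (G.erase g).erase g' := by
      intro a ha
      simp only [mem_filter, mem_insert, mem_singleton, forall_eq_or_imp, forall_eq] at ha
      simp only [mem_erase]
      refine ⟨?_, ?_, ha.1⟩
      · rintro rfl; exact hc' ha.2
      · rintro rfl; exact hc ha.2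
    have := card_le_card hsub
    rw [card_erase_of_mem (mem_erase.2 ⟨hne.symm, hg'⟩), card_erase_of_mem hg] at this
    have : #({i, i + 1} : Finset (Fin (m + 1))) ≤ 2 := card_le_two
    omega
  by_cases hS2 : #S = 2
  · obtain ⟨i, j, hij, rfl⟩ := card_eq_two.1 hS2
    by_cases hj : j = i + 1
    · exact hadj i (by rw [hj])
    by_cases hi : i = j + 1
    · exact hadj j (by rw [hi, pair_comm])
    have hb := hsplit i (by simp) {j} {j} (by simp) (by simp) (by simp [hij, hi])
      (by simp [hij, Ne.symm hj])
    have b1 := card_common_le_two (singleton_nonempty j)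
    omega
  by_cases hS1 : #S = 1
  · obtain ⟨i, rfl⟩ := card_eq_one.1 hS1
    obtain ⟨g, hg, hc⟩ := hpair i
    have hsub : G.filter (fun g => ∀ j ∈ ({i} : Finset _), Covers g j) ⊆ G.erase g := by
      intro a ha
      simp only [mem_filter, mem_singleton, forall_eq] at ha
      rw [mem_erase]
      refine ⟨?_, ha.1⟩
      rintro rfl; exact hc ha.2
    have := card_le_card hsub
    rw [card_erase_of_mem hg] at this
    have : 0 < #G := by omega
    omega
  · have := card_filter_le G fun g => ∀ i ∈ S, Covers g i
    omega

/-- The cyclic order puts a vertex `0` of maximum degree between two vertices chosen so that the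
edges `g₁` and `g₂`, which avoid `0`, avoid one of its two neighbours each. All other vertices
have small degree, and then the hypotheses of `exists_matching` hold at every place. -/
theorem exists_matching_of_max (hm : 4 ≤ m) {G : Finset (Finset (Fin (m + 1)))}
    (h2 : ∀ g ∈ G, #g = 2) (hG : m + 1 ≤ #G) (h6 : 6 ≤ #G)
    (hmax : ∀ i, #{g ∈ G | i ∈ g} ≤ #{g ∈ G | 0 ∈ g}) {g₁ g₂ : Finset (Fin (m + 1))}
    (hg₁ : g₁ ∈ G) (hg₂ : g₂ ∈ G) (hne : g₁ ≠ g₂) (h₁ : 0 ∉ g₁) (h₂ : 0 ∉ g₂)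
    (hl : Fin.last m ∉ g₁) (hf : 1 ∉ g₂) :
    ∃ f : Fin (m + 1) → Finset (Fin (m + 1)), Function.Injective f ∧
      ∀ i, f i ∈ G ∧ ¬ Covers (f i) i := by
  have heq : ∀ g ∈ G, ∀ a b, a ≠ b → a ∈ g → b ∈ g → g = {a, b} := by
    intro g hg a b hab ha hb
    refine (eq_of_subset_of_card_le ?_ ?_).symm
    · simp [insert_subset_iff, ha, hb]
    · rw [h2 g hg, card_pair hab]
  have hcl : ¬ Covers g₁ (Fin.last m) := by simp [Covers, hl, h₁]
  have hcf : ¬ Covers g₂ 0 := by simp [Covers, hf, h₂]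
  have hzero : ∀ i : Fin (m + 1), i + 1 = 0 → i = Fin.last m := fun i hi =>
    add_right_cancel (hi.trans (Fin.last_add_one m).symm)
  refine exists_matching hm h2 hG h6 ?_ ?_
  · intro i
    by_cases hi0 : i = 0
    · exact ⟨g₂, hg₂, hi0 ▸ hcf⟩
    by_cases hi1 : i + 1 = 0
    · exact ⟨g₁, hg₁, hzero i hi1 ▸ hcl⟩
    by_contra! hall
    have hd0 : #{g ∈ G | 0 ∈ g} ≤ 2 := by
      refine le_trans (card_le_card (t := {{0, i}, {0, i + 1}}) fun g hg => ?_) card_le_two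
      rw [mem_filter] at hg
      rw [mem_insert, mem_singleton]
      rcases hall g hg.1 with h | h
      · exact Or.inl (heq g hg.1 _ _ (Ne.symm hi0) hg.2 h)
      · exact Or.inr (heq g hg.1 _ _ (Ne.symm hi1) hg.2 h)
    have hcov : #G ≤ #{g ∈ G | i ∈ g} + #{g ∈ G | i + 1 ∈ g} := by
      refine le_trans (card_le_card fun g hg => ?_) (card_union_le _ _)
      rcases hall g hg with h | h <;> simp [hg, h]
    have := hmax i
    have := hmax (i + 1)
    omega
  · intro i
    by_cases hi1 : i + 1 = 0
    · rw [hi1, hzero i hi1]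
      exact ⟨g₁, hg₁, g₂, hg₂, hne, fun h => hcl h.1, fun h => hcf h.2⟩
    have hinter : #{g ∈ G | i + 1 ∈ g} + #{g ∈ G | 0 ∈ g} ≤ #G + 1 := by
      rw [← card_union_add_card_inter]
      refine Nat.add_le_add (card_le_card (union_subset (filter_subset _ _) (filter_subset _ _)))
        ?_
      refine le_trans (card_le_card (t := {{i + 1, 0}}) fun g hg => ?_) (card_singleton _).le
      simp only [mem_inter, mem_filter] at hg
      exact mem_singleton.2 (heq g hg.1.1 _ _ hi1 hg.1.2 hg.2.2)
    have hmi := hmax (i + 1)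
    have hc := card_filter_add_card_filter_not (s := G) fun g => i + 1 ∈ g
    have he := pred_card_le_card_erase (s := G.filter fun g => i + 1 ∉ g) (a := {i, i + 1 + 1})
    obtain ⟨g, hg, g', hg', hgg⟩ := one_lt_card.1
      (show 1 < #((G.filter fun g => i + 1 ∉ g).erase {i, i + 1 + 1}) by omega)
    have key : ∀ g ∈ (G.filter fun g => i + 1 ∉ g).erase {i, i + 1 + 1},
        ¬ (Covers g i ∧ Covers g (i + 1)) := by
      intro g hg
      rw [mem_erase, mem_filter] at hg
      rintro ⟨h | h, h' | h'⟩
      · exact hg.2.2 h'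
      · exact hg.1 (heq g hg.2.1 _ _ (fin_add_two_ne (by omega) i).symm h h')
      · exact hg.2.2 h
      · exact hg.2.2 h
    exact ⟨g, (mem_filter.1 (mem_erase.1 hg).2).1, g', (mem_filter.1 (mem_erase.1 hg').2).1, hgg,
      key g hg, key g' hg'⟩

end Matching

section FiveVertices

/-- The ten pairs of elements of `Fin 5`. -/
def pairsFive : List (Fin 5 × Fin 5) :=
  [(0, 1), (0, 2), (0, 3), (0, 4), (1, 2), (1, 3), (1, 4), (2, 3), (2, 4), (3, 4)]

/-- The pairs `p` and `q` are disjoint. -/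
def disjPair (p q : Fin 5 × Fin 5) : Bool :=
  p.1 != q.1 && p.1 != q.2 && p.2 != q.1 && p.2 != q.2

/-- The entries of the first list can be matched to disjoint, distinct entries of the second. -/
def matchPairs : List (Fin 5 × Fin 5) → List (Fin 5 × Fin 5) → Bool
  | [], _ => true
  | p :: ps, G => G.any fun q => disjPair p q && matchPairs ps (G.erase q)

/-- The five pairs of consecutive vertices in a cyclic order. -/
def pentagon (s : Fin 5 → Fin 5) : List (Fin 5 × Fin 5) :=
  (List.finRange 5).map fun i => (s i, s (i + 1))

/-- Four cyclic orders of five vertices, which suffice for `exists_pentagon`. -/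
def pentagonOrders : List (Fin 5 → Fin 5) :=
  [![0, 1, 2, 3, 4], ![0, 1, 2, 4, 3], ![0, 1, 3, 2, 4], ![0, 2, 1, 3, 4]]

/-- Finite check: five distinct pairs in `Fin 5`, at least two of which avoid any given vertex, can
be matched to disjoint sides of one of the pentagons. -/
theorem exists_pentagon : ∀ G ∈ pairsFive.sublistsLen 5,
    (∀ v : Fin 5, 2 ≤ G.countP (fun p => v != p.1 && v != p.2)) →
      ∃ s ∈ pentagonOrders, matchPairs (pentagon s) G = true := by
  decide +kernel

theorem exists_forall₂_of_matchPairs : ∀ (ps G : List (Fin 5 × Fin 5)), matchPairs ps G = true →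
    ∃ l, l.Subperm G ∧ List.Forall₂ (fun p q => disjPair p q = true) ps l
  | [], G, _ => ⟨[], List.nil_subperm, List.Forall₂.nil⟩
  | p :: ps, G, h => by
    rw [matchPairs, List.any_eq_true] at h
    obtain ⟨q, hq, h⟩ := h
    rw [Bool.and_eq_true] at h
    obtain ⟨l, hl, hf⟩ := exists_forall₂_of_matchPairs ps (G.erase q) h.2
    exact ⟨q :: l, ((List.subperm_cons q).2 hl).trans
      (List.perm_cons_erase hq).symm.subperm, List.Forall₂.cons h.1 hf⟩

theorem exists_pair_eq : ∀ g : Finset (Fin 5), #g = 2 → ∃ p ∈ pairsFive, {p.1, p.2} = g := by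
  decide +kernel

theorem pairsFive_inj : ∀ p ∈ pairsFive, ∀ q ∈ pairsFive,
    ({p.1, p.2} : Finset (Fin 5)) = {q.1, q.2} → p = q := by
  decide +kernel

theorem pentagonOrders_injective : ∀ s ∈ pentagonOrders, Function.Injective s := by
  decide +kernel

/-- Five two-element subsets of `Fin 5` such that every element lies outside at least two of them
can be matched to the consecutive pairs of some cyclic order so that each pair avoids its set. -/
theorem exists_matching_five {G : Finset (Finset (Fin 5))} (h2 : ∀ g ∈ G, #g = 2) (hG : #G = 5)
    (hdeg : ∀ v, 2 ≤ #{g ∈ G | v ∉ g}) :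
    ∃ s : Fin 5 → Fin 5, Function.Injective s ∧ ∃ f : Fin 5 → Finset (Fin 5),
      Function.Injective f ∧ ∀ i, f i ∈ G ∧ s i ∉ f i ∧ s (i + 1) ∉ f i := by
  set φ : Fin 5 × Fin 5 → Finset (Fin 5) := fun p => {p.1, p.2} with hφ
  have hnd : pairsFive.Nodup := by decide
  have hcount : ∀ P : Finset (Fin 5) → Prop, ∀ _ : DecidablePred P,
      #(G.filter P) = (pairsFive.filter fun p => φ p ∈ G ∧ P (φ p)).length := by
    intro P _
    rw [← List.toFinset_card_of_nodup (hnd.filter _)]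
    symm
    refine card_bij (fun p _ => φ p) ?_ ?_ ?_
    · intro p hp
      rw [List.mem_toFinset, List.mem_filter, decide_eq_true_eq] at hp
      exact mem_filter.2 hp.2
    · intro p hp q hq hpq
      rw [List.mem_toFinset, List.mem_filter] at hp hq
      exact pairsFive_inj p hp.1 q hq.1 hpq
    · intro g hg
      rw [mem_filter] at hg
      obtain ⟨p, hp, hpg⟩ := exists_pair_eq g (h2 g hg.1)
      refine ⟨p, ?_, hpg⟩
      rw [List.mem_toFinset, List.mem_filter, decide_eq_true_eq]
      have : φ p = g := hpg
      rw [this]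
      exact ⟨hp, hg⟩
  set l := pairsFive.filter fun p => φ p ∈ G with hl
  have hlen : l.length = 5 := by
    have := hcount (fun _ => True) inferInstance
    simpa [hG] using this.symm
  obtain ⟨s, hs, hmatch⟩ := exists_pentagon l
    (List.mem_sublistsLen.2 ⟨List.filter_sublist, hlen⟩) (by
      intro v
      refine (hdeg v).trans (le_of_eq ?_)
      rw [hcount, List.countP_eq_length_filter, hl, List.filter_filter]
      congr 2
      funext p
      simp [hφ, and_comm, bne, beq_eq_decide])
  obtain ⟨k, hk, hf⟩ := exists_forall₂_of_matchPairs _ _ hmatch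
  have hklen : k.length = 5 := by rw [← hf.length_eq]; simp [pentagon]
  have hknd : k.Nodup := by
    obtain ⟨k', hkk, hk'⟩ := hk
    exact hkk.nodup_iff.1 (hk'.nodup (hnd.filter _))
  have hkmem : ∀ i (h : i < k.length), k[i] ∈ l := fun i h => hk.subset (List.getElem_mem h)
  refine ⟨s, pentagonOrders_injective s hs, fun i => φ (k[i.val]'(by omega)), ?_, ?_⟩
  · intro i j hij
    have hi := hkmem i (by omega)
    have hj := hkmem j (by omega)
    rw [hl, List.mem_filter] at hi hj
    exact Fin.ext ((hknd.getElem_inj_iff).1 (pairsFive_inj _ hi.1 _ hj.1 hij))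
  · intro i
    have hi := hkmem i (by omega)
    rw [hl, List.mem_filter, decide_eq_true_eq] at hi
    refine ⟨hi.2, ?_⟩
    have hd := hf.get (i := i.val) (by simp [pentagon]) (by omega)
    simp only [pentagon, List.get_eq_getElem, List.getElem_map, List.getElem_finRange,
      disjPair] at hd
    simp [hφ] at hd ⊢
    tauto

end FiveVertices

section Base

variable [DecidableEq α]

/-- The hypergraph version of a matching statement about the complements of the edges. -/
theorem hasCycle_of_matching {V : Finset α} {E : Finset (Finset α)} {m : ℕ}
    {v : Fin (m + 1) → α} (hv : Function.Injective v) (hvV : univ.image v = V)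
    {s : Fin (m + 1) → Fin (m + 1)} (hs : Function.Injective s)
    {f : Fin (m + 1) → Finset (Fin (m + 1))} (hf : Function.Injective f)
    (h : ∀ i, f i ∈ E.image (fun e => univ.filter fun i => v i ∉ e) ∧ s i ∉ f i ∧
      s (i + 1) ∉ f i) : HasCycle E V := by
  have hex : ∀ i, ∃ e ∈ E, (univ.filter fun j => v j ∉ e) = f i := fun i => mem_image.1 (h i).1
  choose e he hef using hex
  refine ⟨m, v ∘ s, e, ⟨hv.comp hs, ?_, ?_, ?_⟩, he, ?_⟩
  · intro i j hij
    exact hf (by rw [← hef i, ← hef j, hij])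
  · intro i
    have := (h i).2.1
    rw [← hef i] at this
    simpa using this
  · intro i
    have := (h i).2.2
    rw [← hef i] at this
    simpa using this
  · rw [← image_image, image_univ_of_surjective (Finite.surjective_of_injective hs), hvV]

/-- The start of the induction, `n = r + 2`. A vertex `b` of minimum degree is contained in two
edges `e₁` and `e₂`; it is placed between a vertex of `e₁` and a vertex of `e₂`. -/
theorem hasCycle_base {V : Finset α} {E : Finset (Finset α)} {r : ℕ} (hr : 3 ≤ r)
    (hV : #V = r + 2) (hE : E ⊆ V.powersetCard r) (hcard : r + 2 ≤ #E)
    (hdeg : ∀ x ∈ V, 2 ≤ #{e ∈ E | x ∈ e}) : HasCycle E V := by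
  have hcompl : ∀ {m : ℕ} (v : Fin (m + 1) → α), Function.Injective v → univ.image v = V →
      ∀ e ∈ E, (univ.filter fun i => v i ∉ e).image v = V \ e := by
    intro m v hv hvV e he
    rw [← hvV]
    ext y
    simp only [mem_image, mem_filter, mem_univ, true_and, mem_sdiff]
    constructor
    · rintro ⟨i, hi, rfl⟩; exact ⟨⟨i, rfl⟩, hi⟩
    · rintro ⟨⟨i, rfl⟩, hi⟩; exact ⟨i, hi, rfl⟩
  have hinj : ∀ {m : ℕ} (v : Fin (m + 1) → α), Function.Injective v → univ.image v = V →
      ∀ e ∈ E, ∀ e' ∈ E, (univ.filter fun i => v i ∉ e) = (univ.filter fun i => v i ∉ e') →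
        e = e' := by
    intro m v hv hvV e he e' he' h
    have h1 := congrArg (image v) h
    rw [hcompl v hv hvV e he, hcompl v hv hvV e' he'] at h1
    have h2 := congrArg (V \ ·) h1
    rwa [Finset.sdiff_sdiff_eq_self (mem_powersetCard.1 (hE he)).1,
      Finset.sdiff_sdiff_eq_self (mem_powersetCard.1 (hE he')).1] at h2
  have htwo : ∀ {m : ℕ} (v : Fin (m + 1) → α), Function.Injective v → univ.image v = V →
      ∀ g ∈ E.image (fun e => univ.filter fun i => v i ∉ e), #g = 2 := by
    intro m v hv hvV g hg
    obtain ⟨e, he, rfl⟩ := mem_image.1 hg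
    obtain ⟨heV, her⟩ := mem_powersetCard.1 (hE he)
    rw [← card_image_of_injective _ hv, hcompl v hv hvV e he, card_sdiff_of_subset heV, hV, her]
    omega
  have hcardG : ∀ {m : ℕ} (v : Fin (m + 1) → α), Function.Injective v → univ.image v = V →
      ∀ P : Finset (Fin (m + 1)) → Prop, ∀ _ : DecidablePred P,
      #((E.image (fun e => univ.filter fun i => v i ∉ e)).filter P) =
        #(E.filter fun e => P (univ.filter fun i => v i ∉ e)) := by
    intro m v hv hvV P _
    rw [filter_image, card_image_of_injOn]
    intro e he e' he' h
    exact hinj v hv hvV e (mem_filter.1 he).1 e' (mem_filter.1 he').1 h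
  have hcardG' : ∀ {m : ℕ} (v : Fin (m + 1) → α), Function.Injective v → univ.image v = V →
      #(E.image (fun e => univ.filter fun i => v i ∉ e)) = #E := by
    intro m v hv hvV
    exact card_image_of_injOn fun e he e' he' h => hinj v hv hvV e he e' he' h
  have hVne : V.Nonempty := card_pos.1 (by omega)
  obtain ⟨b, hb, hmin⟩ := exists_min_image V (fun x => #{e ∈ E | x ∈ e}) hVne
  obtain ⟨e₁, he₁, e₂, he₂, hne⟩ := one_lt_card.1 (hdeg b hb)
  rw [mem_filter] at he₁ he₂
  obtain ⟨h₁V, h₁r⟩ := mem_powersetCard.1 (hE he₁.1)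
  obtain ⟨h₂V, h₂r⟩ := mem_powersetCard.1 (hE he₂.1)
  obtain ⟨x, hx⟩ : (e₁.erase b).Nonempty := by
    rw [← card_pos, card_erase_of_mem he₁.2]; omega
  obtain ⟨y, hy⟩ : ((e₂.erase b).erase x).Nonempty := by
    have := pred_card_le_card_erase (s := e₂.erase b) (a := x)
    rw [card_erase_of_mem he₂.2] at this
    rw [← card_pos]; omega
  simp only [mem_erase] at hx hy
  obtain ⟨v, hv, hvV, h0, h1, hl⟩ := exists_ordering (m := r + 1) hV (by omega) hb
    (h₂V hy.2.2) (h₁V hx.2) hy.2.1.symm hx.1.symm hy.1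
  have hvmem : ∀ i, v i ∈ V := fun i => hvV ▸ mem_image_of_mem _ (mem_univ _)
  have hnot : ∀ i, #{g ∈ E.image (fun e => univ.filter fun i => v i ∉ e) | i ∉ g} =
      #{e ∈ E | v i ∈ e} := by
    intro i
    rw [hcardG v hv hvV]
    simp
  have hmatch : ∃ s : Fin (r + 1 + 1) → Fin (r + 1 + 1), Function.Injective s ∧
      ∃ f : Fin (r + 1 + 1) → Finset (Fin (r + 1 + 1)), Function.Injective f ∧
        ∀ i, f i ∈ E.image (fun e => univ.filter fun i => v i ∉ e) ∧ s i ∉ f i ∧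
          s (i + 1) ∉ f i := by
    by_cases h6 : 6 ≤ #E
    · obtain ⟨f, hf, hf'⟩ := exists_matching_of_max (by omega) (htwo v hv hvV)
        (by rw [hcardG' v hv hvV]; exact hcard) (by rwa [hcardG' v hv hvV])
        (by
          intro i
          have c1 := card_filter_add_card_filter_not
            (s := E.image (fun e => univ.filter fun i => v i ∉ e)) fun g => i ∈ g
          have c2 := card_filter_add_card_filter_not
            (s := E.image (fun e => univ.filter fun i => v i ∉ e)) fun g => 0 ∈ g
          rw [hnot] at c1 c2
          have := hmin (v i) (hvmem i)
          rw [h0] at c2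
          omega)
        (mem_image_of_mem _ he₁.1) (mem_image_of_mem _ he₂.1)
        (fun h => hne (hinj v hv hvV e₁ he₁.1 e₂ he₂.1 h))
        (by simp [h0, he₁.2]) (by simp [h0, he₂.2]) (by simp [hl, hx.2]) (by simp [h1, hy.2.2])
      refine ⟨id, Function.injective_id, f, hf, fun i => ⟨(hf' i).1, ?_⟩⟩
      have := (hf' i).2
      rwa [Covers, not_or] at this
    · obtain rfl : r = 3 := by omega
      exact exists_matching_five (htwo v hv hvV) (by rw [hcardG' v hv hvV]; omega)
        (fun i => by rw [hnot]; exact hdeg _ (hvmem i))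
  obtain ⟨s, hs, f, hf, h⟩ := hmatch
  exact hasCycle_of_matching hv hvV hs hf h

end Base

/-! ### Dense hypergraphs without vertices of degree at most one -/

section Core

variable [DecidableEq α]

/-- Two vertices `u` and `x` outside a complete hypergraph on `W` are absorbed by a path
`a, e, u, f, x, g, b` between two vertices `a` and `b` of `W`. -/
theorem hasCycle_of_complete_sub_two {V : Finset α} {E : Finset (Finset α)} {r : ℕ} (hr : 3 ≤ r)
    (hE : E ⊆ V.powersetCard r) {u x : α} (hx : x ∈ V) (hu : u ∈ V) (hux : u ≠ x)
    (hW : r + 1 ≤ #((V.erase x).erase u)) (hWE : ((V.erase x).erase u).powersetCard r ⊆ E)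
    {e f g : Finset α} (he : e ∈ E) (hf : f ∈ E) (hg : g ∈ E) (hue : u ∈ e) (hxe : x ∉ e)
    (huf : u ∈ f) (hxf : x ∈ f) (hxg : x ∈ g) (hgf : g ≠ f) : HasCycle E V := by
  set W := (V.erase x).erase u with hWdef
  obtain ⟨heV, her⟩ := mem_powersetCard.1 (hE he)
  obtain ⟨hgV, hgr⟩ := mem_powersetCard.1 (hE hg)
  obtain ⟨b, hb⟩ : ((g.erase x).erase u).Nonempty := by
    have := pred_card_le_card_erase (s := g.erase x) (a := u)
    rw [card_erase_of_mem hxg] at this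
    rw [← card_pos]; omega
  obtain ⟨a, ha⟩ : ((e.erase u).erase b).Nonempty := by
    have := pred_card_le_card_erase (s := e.erase u) (a := b)
    rw [card_erase_of_mem hue] at this
    rw [← card_pos]; omega
  simp only [mem_erase] at ha hb
  have hbW : b ∈ W := by simp only [hWdef, mem_erase]; exact ⟨hb.1, hb.2.1, hgV hb.2.2⟩
  have haW : a ∈ W := by
    simp only [hWdef, mem_erase]
    exact ⟨ha.2.1, fun h => hxe (h ▸ ha.2.2), heV ha.2.2⟩
  have huW : u ∉ W := by simp [hWdef]
  have hxW : x ∉ insert u W := by simp [hWdef, hux.symm]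
  have hnot : ∀ {c : α} {h : Finset α}, c ∈ h → c ∉ W → h ∉ W.powersetCard r :=
    fun hc hcW hh => hcW ((mem_powersetCard.1 hh).1 hc)
  have hxW' : x ∉ W := fun h => hxW (mem_insert_of_mem h)
  have hp := hasPath_complete (by omega) hW hbW haW (Ne.symm ha.1)
  have hp1 := hp.snoc huW (hnot hue huW) ha.2.2 hue
  have hp2 := hp1.snoc (f := f) hxW (by
    rw [mem_insert, not_or]
    exact ⟨fun h => hxe (h ▸ hxf), hnot huf huW⟩) huf hxf
  have hc := hp2.close (f := g) (by
    rw [mem_insert, mem_insert, not_or, not_or]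
    exact ⟨hgf, fun h => hxe (h ▸ hxg), hnot hxg hxW'⟩) hb.2.2 hxg
  have hV : insert x (insert u W) = V := by
    rw [hWdef, insert_erase (mem_erase.2 ⟨hux, hu⟩), insert_erase hx]
  rw [hV] at hc
  refine hc.mono ?_
  simp only [insert_subset_iff]
  exact ⟨hg, hf, he, hWE⟩

/-- If all degrees are at least two and some vertex `u` has degree at most one after the deletion
of `x`, then the other vertices span a complete hypergraph. -/
theorem hasCycle_of_degree_le_one {V : Finset α} {E : Finset (Finset α)} {N r : ℕ} (hr : 3 ≤ r)
    (hV : #V = N + 2) (hN : r + 1 ≤ N) (hE : E ⊆ V.powersetCard r) {u x : α} (hx : x ∈ V)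
    (hu : u ∈ V.erase x) (hcard : N.choose r < #{e ∈ E | x ∉ e})
    (hdeg : ∀ y ∈ V, 2 ≤ #{e ∈ E | y ∈ e})
    (hu1 : #{e ∈ {e ∈ E | x ∉ e} | u ∈ e} ≤ 1) : HasCycle E V := by
  have hsub := filter_not_mem_subset (filter_not_mem_subset hE x) u
  have hc := card_filter_add_card_filter_not (s := {e ∈ E | x ∉ e}) fun e => u ∈ e
  have hWc : #((V.erase x).erase u) = N := by
    rw [card_erase_of_mem hu, card_erase_of_mem hx, hV]; rfl
  have hle := card_le_card hsub
  rw [card_powersetCard, hWc] at hle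
  have heq := eq_of_subset_of_card_le hsub (by rw [card_powersetCard, hWc]; omega)
  obtain ⟨e, he⟩ := card_eq_one.1
    (show #{e ∈ {e ∈ E | x ∉ e} | u ∈ e} = 1 by omega)
  have hemem : e ∈ {e ∈ {e ∈ E | x ∉ e} | u ∈ e} := he ▸ mem_singleton_self e
  simp only [mem_filter] at hemem
  obtain ⟨f, hf⟩ : ({e ∈ E | u ∈ e}.erase e).Nonempty := by
    have := pred_card_le_card_erase (s := {e ∈ E | u ∈ e}) (a := e)
    have := hdeg u (mem_erase.1 hu).2
    rw [← card_pos]; omega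
  simp only [mem_erase, mem_filter] at hf
  have hxf : x ∈ f := by
    by_contra hxf
    have : f ∈ {e ∈ {e ∈ E | x ∉ e} | u ∈ e} := by simp [hf.2, hxf]
    rw [he, mem_singleton] at this
    exact hf.1 this
  obtain ⟨g, hg⟩ : ({e ∈ E | x ∈ e}.erase f).Nonempty := by
    have := pred_card_le_card_erase (s := {e ∈ E | x ∈ e}) (a := f)
    have := hdeg x hx
    rw [← card_pos]; omega
  simp only [mem_erase, mem_filter] at hg
  refine hasCycle_of_complete_sub_two hr hE hx (mem_erase.1 hu).2 (mem_erase.1 hu).1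
    (by omega) ?_ hemem.1.1 hf.2.1 hg.2.1 hemem.2 hemem.1.2 hf.2.2 hxf hg.2.2 hg.1
  rw [← heq]
  exact (filter_subset _ _).trans (filter_subset _ _)

/-- A Berge cycle through all vertices but `x` extends to `x` if the degree of `x` is large. -/
theorem hasCycle_of_hasCycle_erase {V : Finset α} {E : Finset (Finset α)} {m t : ℕ}
    (hV : #V = m + 4) (hm : t + 2 ≤ m) (hE : E ⊆ V.powersetCard (t + 3)) {x : α} (hx : x ∈ V)
    (hc : HasCycle {e ∈ E | x ∉ e} (V.erase x))
    (hcard : (m + 2).choose (t + 2) < 2 * #{e ∈ E | x ∈ e}) : HasCycle E V := by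
  obtain ⟨k, v, e, hc, heE, hvV⟩ := hc
  obtain rfl : k = m + 2 := by
    have h1 := card_image_of_injective univ hc.inj_v
    rw [hvV, card_erase_of_mem hx, hV, card_univ, Fintype.card_fin] at h1
    omega
  have hxv : x ∉ univ.image v := by rw [hvV]; simp
  obtain ⟨i, A, hA, B, hB, hne, hiA, hiB⟩ := exists_insertion hc.inj_v hm hxv
    (D := {e ∈ E | x ∈ e})
    (by rw [hvV, insert_erase hx]; exact (filter_subset _ _).trans hE)
    (fun e he => (mem_filter.1 he).2) hcard
  rw [mem_filter] at hA hB
  have hp := hc.hasPath i (E := {e ∈ E | x ∉ e}) fun j _ => heE j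
  have hp1 := hp.snoc hxv (f := A) (by simp [hA.2]) hiA hA.2
  have hc' := hp1.close (f := B) (by
    rw [mem_insert, not_or]
    exact ⟨hne.symm, by simp [hB.2]⟩) hiB hB.2
  rw [hvV, insert_erase hx] at hc'
  refine hc'.mono ?_
  simp only [insert_subset_iff]
  exact ⟨hB.1, hA.1, filter_subset _ _⟩

/-- An `r`-uniform hypergraph on `n ≥ r + 2` vertices with more than `(n - 1).choose r` edges and
without vertices of degree at most one has a Hamiltonian Berge cycle. -/
theorem hasCycle_of_two_le_degree {r : ℕ} (hr : 3 ≤ r) (q : ℕ) :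
    ∀ (V : Finset α) (E : Finset (Finset α)), #V = r + 2 + q → E ⊆ V.powersetCard r →
      (r + 1 + q).choose r < #E → (∀ x ∈ V, 2 ≤ #{e ∈ E | x ∈ e}) → HasCycle E V := by
  induction q with
  | zero =>
    intro V E hV hE hcard hdeg
    refine hasCycle_base hr hV hE ?_ hdeg
    rw [add_zero, Nat.choose_succ_self_right] at hcard
    omega
  | succ q ih =>
    intro V E hV hE hcard hdeg
    obtain ⟨t, rfl⟩ : ∃ t, r = t + 3 := ⟨r - 3, by omega⟩
    obtain ⟨x, hx, hxc, hxd⟩ := exists_vertex (N := t + 3 + 1 + q) (s := t + 2)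
      (by omega) (by omega) hE hcard
    by_cases hall : ∀ u ∈ V.erase x, 2 ≤ #{e ∈ {e ∈ E | x ∉ e} | u ∈ e}
    · refine hasCycle_of_hasCycle_erase (m := t + 2 + q) (t := t) (by omega) (by omega) hE hx
        (ih _ _ ?_ (filter_not_mem_subset hE x) hxc hall) ?_
      · rw [card_erase_of_mem hx]; omega
      · rwa [show t + 2 + q + 2 = t + 3 + 1 + q by omega]
    · push Not at hall
      obtain ⟨u, hu, hu1⟩ := hall
      exact hasCycle_of_degree_le_one (N := t + 3 + 1 + q) hr (by omega) (by omega) hE hx hu hxc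
        hdeg (by omega)

end Core

/-! ### Hamiltonian cycles and paths in dense uniform hypergraphs -/

section Dense

variable [DecidableEq α]

/-- If there is a vertex `x` of degree at most one, then counting leaves no room for a missing edge
among the other vertices. -/
theorem hasCycle_or_eq_insert {V : Finset α} {E : Finset (Finset α)} {n r : ℕ} (hr : 3 ≤ r)
    (hn : r + 2 ≤ n) (hV : #V = n) (hE : E ⊆ V.powersetCard r) (hcard : (n - 1).choose r < #E) :
    HasCycle E V ∨ ∃ x ∈ V, ∃ e ∈ E, x ∈ e ∧ E = insert e ((V.erase x).powersetCard r) := by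
  obtain ⟨q, rfl⟩ : ∃ q, n = r + 2 + q := ⟨n - (r + 2), by omega⟩
  by_cases hdeg : ∀ x ∈ V, 2 ≤ #{e ∈ E | x ∈ e}
  · refine Or.inl (hasCycle_of_two_le_degree hr q V E hV hE ?_ hdeg)
    rwa [show r + 2 + q - 1 = r + 1 + q by omega] at hcard
  · right
    push Not at hdeg
    obtain ⟨x, hx, hx1⟩ := hdeg
    have hsub := filter_not_mem_subset hE x
    have hle := card_filter_not_mem_le hE hx
    have hc := card_filter_add_card_filter_not (s := E) fun e => x ∈ e
    rw [hV] at hle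
    have heq := eq_of_subset_of_card_le hsub (by
      rw [card_powersetCard, card_erase_of_mem hx, hV]; omega)
    obtain ⟨e, he⟩ := card_eq_one.1 (show #{e ∈ E | x ∈ e} = 1 by omega)
    have hemem : e ∈ {e ∈ E | x ∈ e} := he ▸ mem_singleton_self e
    rw [mem_filter] at hemem
    refine ⟨x, hx, e, hemem.1, hemem.2, ?_⟩
    rw [← heq, insert_eq, ← he, filter_union_filter_not_eq]

/-- A path is obtained from a cycle in the hypergraph with one further edge `f`. If some vertex
`x` has degree one, then `f` is chosen to contain `x`. -/
theorem hasPath_or_eq {V : Finset α} {E : Finset (Finset α)} {n r : ℕ} (hr : 3 ≤ r)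
    (hn : r + 2 ≤ n) (hV : #V = n) (hE : E ⊆ V.powersetCard r) (hcard : (n - 1).choose r ≤ #E) :
    (∃ a b, HasPath E V a b) ∨ ∃ x ∈ V, E = (V.erase x).powersetCard r := by
  obtain ⟨q, rfl⟩ : ∃ q, n = r + 2 + q := ⟨n - (r + 2), by omega⟩
  rw [show r + 2 + q - 1 = r + 1 + q by omega] at hcard
  suffices h : (∃ f ∈ V.powersetCard r, (r + 1 + q).choose r < #(insert f E) ∧
      ∀ x ∈ V, 2 ≤ #{e ∈ insert f E | x ∈ e}) ∨ ∃ x ∈ V, E = (V.erase x).powersetCard r by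
    refine h.imp_left fun ⟨f, hf, hfc, hfd⟩ => HasCycle.exists_hasPath (f := f) ?_
    exact hasCycle_of_two_le_degree hr q V _ hV (insert_subset hf hE) hfc hfd
  have hmono : ∀ f x, #{e ∈ E | x ∈ e} ≤ #{e ∈ insert f E | x ∈ e} := fun f x =>
    card_le_card (filter_subset_filter _ (subset_insert _ _))
  by_cases hdeg : ∀ x ∈ V, 2 ≤ #{e ∈ E | x ∈ e}
  · left
    by_cases hall : V.powersetCard r ⊆ E
    · obtain ⟨f, hf⟩ : (V.powersetCard r).Nonempty := powersetCard_nonempty.2 (by omega)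
      refine ⟨f, hf, ?_, fun x hx => (hdeg x hx).trans (hmono f x)⟩
      rw [insert_eq_self.2 (hall hf)]
      have := card_le_card hall
      rw [card_powersetCard, hV, show r + 2 + q = (r + 1 + q) + 1 by omega] at this
      refine lt_of_lt_of_le ?_ this
      obtain ⟨s, rfl⟩ : ∃ s, r = s + 1 := ⟨r - 1, by omega⟩
      rw [Nat.choose_succ_succ, Nat.succ_eq_add_one]
      have := Nat.choose_pos (show s ≤ s + 1 + 1 + q by omega)
      omega
    · obtain ⟨f, hf, hfE⟩ := not_subset.1 hall
      refine ⟨f, hf, ?_, fun x hx => (hdeg x hx).trans (hmono f x)⟩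
      rw [card_insert_of_notMem hfE]
      omega
  push Not at hdeg
  obtain ⟨x, hx, hx1⟩ := hdeg
  have hsub := filter_not_mem_subset hE x
  have hc := card_filter_add_card_filter_not (s := E) fun e => x ∈ e
  have hVx : #(V.erase x) = r + 1 + q := by rw [card_erase_of_mem hx, hV]; omega
  by_cases hx0 : #{e ∈ E | x ∈ e} = 0
  · right
    refine ⟨x, hx, ?_⟩
    rw [← eq_of_subset_of_card_le hsub (by rw [card_powersetCard, hVx]; omega)]
    rw [card_eq_zero, filter_eq_empty_iff] at hx0
    exact (filter_true_of_mem fun e he => hx0 he).symm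
  left
  obtain ⟨e, he⟩ := card_eq_one.1 (show #{e ∈ E | x ∈ e} = 1 by omega)
  -- an `r`-set containing `x` other than the unique edge `e` at `x`
  obtain ⟨g, hg, hge⟩ : ∃ g ∈ (V.erase x).powersetCard (r - 1), g ≠ e.erase x := by
    refine exists_mem_ne ?_ _
    rw [card_powersetCard, hVx]
    have h1 : (r - 1 + 1).choose (r - 1) ≤ (r + 1 + q).choose (r - 1) :=
      Nat.choose_le_choose _ (by omega)
    rw [Nat.choose_succ_self_right] at h1
    omega
  obtain ⟨hgV, hgr⟩ := mem_powersetCard.1 hg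
  have hxg : x ∉ g := fun h => by simpa using hgV h
  have hfE : insert x g ∉ E := by
    intro h
    have : insert x g ∈ {e ∈ E | x ∈ e} := by simp [h]
    rw [he, mem_singleton] at this
    exact hge (by rw [← this, erase_insert hxg])
  refine ⟨insert x g, ?_, ?_, ?_⟩
  · rw [mem_powersetCard, card_insert_of_notMem hxg, hgr]
    exact ⟨insert_subset hx (hgV.trans (erase_subset _ _)), by omega⟩
  · rw [card_insert_of_notMem hfE]; omega
  · intro y hy
    by_cases hyx : y = x
    · subst hyx
      rw [filter_insert, if_pos (mem_insert_self _ _),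
        card_insert_of_notMem fun h => hfE (mem_filter.1 h).1]
      omega
    · -- at most one `r`-subset of `V.erase x` is missing, so `y` keeps a large degree
      refine le_trans ?_ (hmono _ y)
      have hle : #{e ∈ {e ∈ E | x ∉ e} | y ∈ e} ≤ #{e ∈ E | y ∈ e} :=
        card_le_card (filter_subset_filter _ (filter_subset _ _))
      have hc' := card_filter_add_card_filter_not (s := {e ∈ E | x ∉ e}) fun e => y ∈ e
      have hny := card_filter_not_mem_le hsub (mem_erase.2 ⟨hyx, hy⟩)
      rw [hVx, show r + 1 + q - 1 = r + q by omega] at hny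
      obtain ⟨s, rfl⟩ : ∃ s, r = s + 1 := ⟨r - 1, by omega⟩
      rw [show s + 1 + 1 + q = (s + 1 + q) + 1 by omega, Nat.choose_succ_succ] at hcard
      have h1 : (s + 1).choose s ≤ (s + 1 + q).choose s := Nat.choose_le_choose _ (by omega)
      rw [Nat.choose_succ_self_right] at h1
      simp only [Nat.succ_eq_add_one] at hcard
      omega

end Dense

/-! ### Translation to `Hypergraph` -/

section Transfer

open Hypergraph

variable {H : Hypergraph α}

/-- A uniform hypergraph on finitely many vertices, encoded by a finite set of vertices and a finite
set of finite edges. -/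
theorem exists_finset_model {r : ℕ} (hfin : H.vertexSet.Finite) (hH : H.IsUniform r) :
    ∃ (V : Finset α) (E : Finset (Finset α)), (V : Set α) = H.vertexSet ∧
      E ⊆ V.powersetCard r ∧ (∀ s : Finset α, s ∈ E ↔ (s : Set α) ∈ H.edgeSet) ∧
      #E = H.edgeSet.ncard := by
  classical
  have hsub : ∀ s ∈ H.edgeSet, s ⊆ H.vertexSet := fun s hs =>
    H.subset_vertexSet_of_mem_edgeSet' hs
  set E : Finset (Finset α) :=
    (hfin.toFinset.powersetCard r).filter fun s : Finset α => (s : Set α) ∈ H.edgeSet with hE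
  have hmem : ∀ s : Finset α, s ∈ E ↔ (s : Set α) ∈ H.edgeSet := by
    intro s
    rw [hE, mem_filter, mem_powersetCard, and_iff_right_iff_imp]
    intro hs
    refine ⟨fun y hy => hfin.mem_toFinset.2 (hsub _ hs hy), ?_⟩
    rw [← Set.ncard_coe_finset, hH _ hs]
  refine ⟨hfin.toFinset, E, hfin.coe_toFinset, filter_subset _ _, hmem, ?_⟩
  rw [← Set.ncard_coe_finset, 
    ← Set.ncard_image_of_injective _
      (coe_injective : Function.Injective ((↑) : Finset α → Set α))]
  congr 1
  ext s
  constructor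
  · rintro ⟨t, ht, rfl⟩
    exact (hmem t).1 ht
  · intro hs
    obtain ⟨t, rfl⟩ := (hfin.subset (hsub s hs)).exists_finset_coe
    exact ⟨t, (hmem t).2 hs, rfl⟩

theorem hasHamiltonianBergeCycle_of_hasCycle [DecidableEq α] {V : Finset α}
    {E : Finset (Finset α)} (hV : (V : Set α) = H.vertexSet)
    (hE : ∀ s ∈ E, (s : Set α) ∈ H.edgeSet) (h : HasCycle E V) : H.HasHamiltonianBergeCycle := by
  obtain ⟨m, v, e, hc, heE, hvV⟩ := h
  have hrange : Set.range v = H.vertexSet := by rw [← hV, ← hvV]; simp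
  -- `e i` joins `v i` to `v (i + 1)` in `IsCyc`, and `v (i - 1)` to `v i` in `IsBergeCycle`
  refine ⟨m + 1, v, fun i => (e (i - 1) : Set α), ⟨?_, ?_, hc.inj_v, ?_, ?_, ?_⟩, hrange⟩
  · exact fun i => hrange ▸ Set.mem_range_self i
  · exact fun i => hE _ (heE _)
  · intro i j hij
    exact sub_left_injective (hc.inj_e (coe_injective hij))
  · intro i
    have := hc.mem_next (i - 1)
    rwa [sub_add_cancel] at this
  · intro i
    have := hc.mem i
    rw [finRotate_apply]
    simpa using this

theorem hasHamiltonianBergePath_of_hasPath [DecidableEq α] {V : Finset α}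
    {E : Finset (Finset α)} {a b : α} (hV : (V : Set α) = H.vertexSet)
    (hE : ∀ s ∈ E, (s : Set α) ∈ H.edgeSet) (h : HasPath E V a b) :
    H.HasHamiltonianBergePath := by
  obtain ⟨k, v, e, hv, he, heE, hl, hr, hvV, -, -⟩ := h
  have hrange : Set.range v = H.vertexSet := by rw [← hV, ← hvV]; simp
  exact ⟨k, v, fun i => (e i : Set α), ⟨fun i => hrange ▸ Set.mem_range_self i,
    fun i => hE _ (heE _), hv, fun i j hij => he (coe_injective hij), hl, hr⟩, hrange⟩

theorem exists_equiv_option {n : ℕ} (hn : 1 ≤ n) (hV : H.vertexSet.ncard = n)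
    (x : H.vertexSet) : ∃ φ : H.vertexSet ≃ Option (Fin (n - 1)), φ x = none := by
  classical
  have : Finite H.vertexSet := Set.finite_of_ncard_pos (by omega)
  have hc : Nat.card H.vertexSet = Nat.card (Option (Fin (n - 1))) := by
    rw [Nat.card_coe_set_eq, hV, Nat.card_eq_fintype_card, Fintype.card_option, Fintype.card_fin]
    omega
  obtain ⟨φ⟩ := Finite.card_eq.1 hc
  exact ⟨φ.trans (Equiv.swap (φ x) none), by simp⟩

theorem mem_cliqueAddVertex_iff {n r : ℕ} {x : H.vertexSet}
    {φ : H.vertexSet ≃ Option (Fin (n - 1))} (hφ : φ x = none) (s : Set H.vertexSet) :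
    φ '' s ∈ (cliqueAddVertex (n - 1) r).edgeSet ↔
      (x : α) ∉ Subtype.val '' s ∧ (Subtype.val '' s).ncard = r := by
  change none ∉ φ '' s ∧ (φ '' s).ncard = r ↔ _
  rw [Set.ncard_image_of_injective _ φ.injective,
    Set.ncard_image_of_injective _ Subtype.val_injective, ← hφ, φ.injective.mem_set_image,
    Subtype.val_injective.mem_set_image]

theorem isIsomorphic_cliqueAddVertex {n r : ℕ} (hn : 1 ≤ n) (hV : H.vertexSet.ncard = n) {x : α}
    (hx : x ∈ H.vertexSet)
    (h : ∀ s ⊆ H.vertexSet, s ∈ H.edgeSet ↔ x ∉ s ∧ s.ncard = r) :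
    H.IsIsomorphic (cliqueAddVertex (n - 1) r) := by
  obtain ⟨φ, hφ⟩ := exists_equiv_option hn hV ⟨x, hx⟩
  refine ⟨φ.trans (Equiv.Set.univ _).symm, fun s => ?_⟩
  rw [h _ (Subtype.coe_image_subset _ _), ← mem_cliqueAddVertex_iff hφ, ← Set.image_comp]
  rfl

theorem isIsomorphicToCliqueAddEdge {n r : ℕ} (hn : 1 ≤ n) (hV : H.vertexSet.ncard = n) {x : α}
    (hx : x ∈ H.vertexSet) {e : Set α} (he : e ⊆ H.vertexSet) (hxe : x ∈ e) (her : e.ncard = r)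
    (h : ∀ s ⊆ H.vertexSet, s ∈ H.edgeSet ↔ s = e ∨ (x ∉ s ∧ s.ncard = r)) :
    H.IsIsomorphicToCliqueAddEdge (n - 1) r := by
  obtain ⟨φ, hφ⟩ := exists_equiv_option hn hV ⟨x, hx⟩
  have hval : (Subtype.val '' (Subtype.val ⁻¹' e : Set H.vertexSet)) = e := by
    rw [Subtype.image_preimage_coe, Set.inter_eq_right.2 he]
  refine ⟨φ '' (Subtype.val ⁻¹' e), ⟨⟨x, hx⟩, hxe, hφ⟩, ?_,
    φ.trans (Equiv.Set.univ _).symm, fun s => ?_⟩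
  · rw [Set.ncard_image_of_injective _ φ.injective,
      ← Set.ncard_image_of_injective _ Subtype.val_injective, hval, her]
  · have h1 : Subtype.val '' s = e ↔ φ '' s = φ '' (Subtype.val ⁻¹' e) := by
      rw [φ.injective.image_injective.eq_iff,
        ← (Subtype.val_injective (p := (· ∈ H.vertexSet))).image_injective.eq_iff, hval]
    rw [h _ (Subtype.coe_image_subset _ _), h1, ← mem_cliqueAddVertex_iff hφ, ← Set.image_comp]
    rfl

end Transfer

end BergeHam

theorem mainTheorem1 {α : Type*} (r n : ℕ) (hr : 3 ≤ r) (hn : r + 2 ≤ n)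
    (H : Hypergraph α) (hV : H.vertexSet.ncard = n) (hH : H.IsUniform r) :
    ((n - 1).choose r ≤ H.edgeSet.ncard →
      ¬ H.IsIsomorphic (Hypergraph.cliqueAddVertex (n - 1) r) →
        H.HasHamiltonianBergePath) ∧
    ((n - 1).choose r < H.edgeSet.ncard →
      ¬ H.IsIsomorphicToCliqueAddEdge (n - 1) r →
        H.HasHamiltonianBergeCycle) := by
  classical
  have hfin : H.vertexSet.Finite := Set.finite_of_ncard_pos (by omega)
  obtain ⟨V, E, hVH, hE, hEH, hcE⟩ := BergeHam.exists_finset_model hfin hH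
  have hVn : V.card = n := by rw [← hV, ← hVH, Set.ncard_coe_finset]
  have hmem : ∀ x, x ∈ V ↔ x ∈ H.vertexSet := fun x => by rw [← hVH, Finset.mem_coe]
  have hpow : ∀ x, ∀ t : Finset α, (t : Set α) ⊆ H.vertexSet →
      (t ∈ (V.erase x).powersetCard r ↔ x ∉ (t : Set α) ∧ (t : Set α).ncard = r) := by
    intro x t ht
    rw [← hVH, Finset.coe_subset] at ht
    rw [Finset.mem_powersetCard, Finset.subset_erase, Set.ncard_coe_finset, Finset.mem_coe]
    tauto
  rw [← hcE]
  refine ⟨fun hcard hiso => ?_, fun hcard hiso => ?_⟩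
  · rcases BergeHam.hasPath_or_eq hr hn hVn hE hcard with ⟨a, b, h⟩ | ⟨x, hx, h⟩
    · exact BergeHam.hasHamiltonianBergePath_of_hasPath hVH (fun s hs => (hEH s).1 hs) h
    · refine absurd (BergeHam.isIsomorphic_cliqueAddVertex (by omega) hV ((hmem x).1 hx)
        fun s hs => ?_) hiso
      obtain ⟨t, rfl⟩ := (hfin.subset hs).exists_finset_coe
      rw [← hEH, h, hpow x t hs]
  · rcases BergeHam.hasCycle_or_eq_insert hr hn hVn hE hcard with h | ⟨x, hx, e, he, hxe, h⟩
    · exact BergeHam.hasHamiltonianBergeCycle_of_hasCycle hVH (fun s hs => (hEH s).1 hs) h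
    · obtain ⟨heV, her⟩ := Finset.mem_powersetCard.1 (hE he)
      refine absurd (BergeHam.isIsomorphicToCliqueAddEdge (by omega) hV ((hmem x).1 hx)
        (e := e) (by rw [← hVH]; exact_mod_cast heV) hxe (by rw [Set.ncard_coe_finset, her])
        fun s hs => ?_) hiso
      obtain ⟨t, rfl⟩ := (hfin.subset hs).exists_finset_coe
      rw [← hEH, h, Finset.mem_insert, hpow x t hs, Finset.coe_inj]
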